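/- Work in Cantor space $2^\omega$ with the fair-coin measure $\mu$. For $\sigma\in 2^{<\omega}$ let $[\sigma]$ be the set of all $X\in 2^\omega$ extending $\sigma$; the basic open sets are the sets $[\sigma]$ and $\varnothing$. A sequence of functions $f_n\colon 2^\omega\to[0,\infty)$ is a uniformly computable sequence of total computable functions if a single oracle algorithm, given $n$, $k$ and the oracle $X$, halts for all $n,k,X$ and outputs a dyadic rational within $2^{-k}$ of $f_n(X)$. A function $t\colon 2^\omega\to[0,\infty]$ is lower semicomputable if $t=\sum_n g_n$ for some uniformly computable sequence $\langle g_n\rangle$ of total computable functions $g_n\colon 2^\omega\to[0,\infty)$. A Schnorr test is a sequence $\langle U_n\rangle$ of subsets of $2^\omega$ such that $U_n=\bigcup_s C_{n,s}$ for a computable double sequence $\langle C_{n,s}\rangle$ of basic open sets, $\mu(U_n)\le 2^{-n}$ for all $n$, and the reals $\mu(U_n)$ are computable uniformly in $n$. A point $A\in 2^\omega$ is Schnorr random if $A\notin\bigcap_n U_n$ for every Schnorr test $\langle U_n\rangle$. **Lemma (Key lemma).** Let $t\colon 2^\omega\to[0,\infty]$ be a lower semicomputable function whose integral $\int t\,d\mu$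 is a (finite) computable real number. Then there is a uniformly computable sequence $\langle h_n\rangle$ of total computable functions $h_n\colon 2^\omega\to[0,\infty)$ such that $h_n(X)\le t(X)$ for all $n$ and all $X\in 2^\omega$, and such that for every Schnorr random $A\in 2^\omega$ there is some $n$ with $h_n(A)=t(A)$. -/

import Mathlib

open MeasureTheory
open scoped NNReal ENNReal

namespace Schnorr

/-- Cantor space `2^ω`, with its product topology and product σ-algebra. -/
abbrev Cantor : Type := ℕ → Bool

/-- The fair-coin measure on `2^ω`: the countable product of the uniform measure on `{0, 1}`. -/
noncomputable def coin : Measure Cantor :=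
  Measure.infinitePi fun _ : ℕ => (PMF.uniformOfFintype Bool).toMeasure

/-- The initial segment `X(0) X(1) … X(n-1)` of `X`. -/
def initSeg (X : Cantor) (n : ℕ) : List Bool := (List.range n).map X

/-- The basic open set `[σ]` of all `X` that extend the finite string `σ`. -/
def basicCyl (σ : List Bool) : Set Cantor := {X | initSeg X σ.length = σ}

/-- The basic open sets: the cylinders and (coded by `none`) the empty set. -/
def basicOpen : Option (List Bool) → Set Cantor
  | none => ∅
  | some σ => basicCyl σ

/-- `q` is (the numerator of) a dyadic approximation of precision `k` to `x`:
`|x - q / 2^k| ≤ 2^(-k)`. -/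
def DyadicApprox (x : ℝ≥0) (k q : ℕ) : Prop :=
  |(x : ℝ) - (q : ℝ) / 2 ^ k| ≤ (2 ^ k)⁻¹

/-- A computable nonnegative real number. -/
def ComputableNNReal (x : ℝ≥0) : Prop :=
  ∃ a : ℕ → ℕ, Computable a ∧ ∀ k, DyadicApprox x k (a k)

/-- A uniformly computable sequence of nonnegative real numbers. -/
def UniformlyComputableNNReal (x : ℕ → ℝ≥0) : Prop :=
  ∃ a : ℕ → ℕ → ℕ, Computable₂ a ∧ ∀ n k, DyadicApprox (x n) k (a n k)

/-- A uniformly computable sequence of total computable functions `f n : 2^ω → [0, ∞)`: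
there is a single algorithm (a Turing functional, given by a partial computable function `Φ` on
finite pieces of the oracle) that from `n`, a precision `k` and oracle `X` produces a dyadic
approximation of precision `k` to `f n X`. For every oracle the algorithm halts after reading some
finite initial segment, and an output produced after reading `σ` only is correct for every
oracle that extends `σ`. -/
def UniformlyComputableFun (f : ℕ → Cantor → ℝ≥0) : Prop :=
  ∃ Φ : (ℕ × ℕ) × List Bool →. ℕ, Partrec Φ ∧
    (∀ n k X, ∃ m, (Φ ((n, k), initSeg X m)).Dom) ∧
    (∀ n k σ q, q ∈ Φ ((n, k), σ) → ∀ X ∈ basicCyl σ, DyadicApprox (f n X) k q)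

/-- `t : 2^ω → [0, ∞]` is lower semicomputable: it is the sum of a uniformly computable sequence
of total computable functions with values in `[0, ∞)`. -/
def LowerSemicomputable (t : Cantor → ℝ≥0∞) : Prop :=
  ∃ g : ℕ → Cantor → ℝ≥0, UniformlyComputableFun g ∧ ∀ X, t X = ∑' n, (g n X : ℝ≥0∞)

/-- A uniform sequence of effectively open (`Σ⁰₁`) subsets of `2^ω`. -/
def UniformlySigma01 (U : ℕ → Set Cantor) : Prop :=
  ∃ C : ℕ → ℕ → Option (List Bool), Computable₂ C ∧ ∀ n, U n = ⋃ s, basicOpen (C n s)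

/-- A Martin-Löf test. -/
def IsMartinLofTest (U : ℕ → Set Cantor) : Prop :=
  UniformlySigma01 U ∧ ∀ n, coin (U n) ≤ ((2 : ℝ≥0∞) ^ n)⁻¹

/-- A Schnorr test: a Martin-Löf test whose measures `μ (U n)` are uniformly computable. -/
def IsSchnorrTest (U : ℕ → Set Cantor) : Prop :=
  IsMartinLofTest U ∧ UniformlyComputableNNReal fun n => (coin (U n)).toNNReal

/-- `A` is Schnorr random if it is covered by no Schnorr test. -/
def SchnorrRandom (A : Cantor) : Prop :=
  ∀ U : ℕ → Set Cantor, IsSchnorrTest U → A ∉ ⋂ n, U n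

end Schnorr

/-! Write `t` as the supremum of increasing computable dyadic step functions `t_m`, where `t_m(X)`
depends only on `X ↾ m` (`LowerSemicomputable.exists_stepVal`). As `∫ t` is computable, one can
search for levels `M k` with `∫ t - ∫ t_{M k} ≤ 4^(-k)` (`exists_levels`). By Markov's inequality
the set `V_k` where `t_{M (k+1)} - t_{M k} > 2^(-k)` has measure at most `2^(-k)`. Each `V_k` is
clopen, and the tails `⋃_{k > n} V_k` have computable measure, so they form a Schnorr test
(`isSchnorrTest_jumpSet`).

Let `h_n` follow `t_{M n}, t_{M (n+1)}, …` and freeze just before the first large jump. The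
increments are then dominated by a geometric series, so `h_n` is total computable, and it stays
below `t`. A Schnorr random `A` lies outside some tail; started beyond that point, the climb never
freezes and reaches `t(A)`. -/

namespace Schnorr

/-! ### Closure properties of computable functions. -/

section Computability

variable {α : Type*} [Primcodable α]

theorem computable₂_pow : Computable₂ ((· ^ ·) : ℕ → ℕ → ℕ) :=
  (Primrec₂.unpaired'.1 Nat.Primrec.pow).to_comp

theorem _root_.Computable.nat_add' {f g : α → ℕ} (hf : Computable f) (hg : Computable g) :
    Computable fun a => f a + g a :=
  Primrec.nat_add.to_comp.comp hf hg

theorem _root_.Computable.nat_sub' {f g : α → ℕ} (hf : Computable f) (hg : Computable g) :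
    Computable fun a => f a - g a :=
  Primrec.nat_sub.to_comp.comp hf hg

theorem _root_.Computable.nat_mul' {f g : α → ℕ} (hf : Computable f) (hg : Computable g) :
    Computable fun a => f a * g a :=
  Primrec.nat_mul.to_comp.comp hf hg

theorem _root_.Computable.nat_div' {f g : α → ℕ} (hf : Computable f) (hg : Computable g) :
    Computable fun a => f a / g a :=
  Primrec.nat_div.to_comp.comp hf hg

theorem _root_.Computable.nat_pow' {f g : α → ℕ} (hf : Computable f) (hg : Computable g) :
    Computable fun a => f a ^ g a :=
  computable₂_pow.comp hf hg

theorem _root_.Computable.list_take' {β : Type*} [Primcodable β] {f : α → ℕ} {g : α → List β}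
    (hf : Computable f) (hg : Computable g) : Computable fun a => (g a).take (f a) :=
  Primrec.list_take.to_comp.comp hf hg

theorem _root_.Computable.decide_le {f g : α → ℕ} (hf : Computable f) (hg : Computable g) :
    Computable fun a => decide (f a ≤ g a) :=
  (PrimrecRel.decide Primrec.nat_le).to_comp.comp hf hg

theorem _root_.Computable.decide_lt {f g : α → ℕ} (hf : Computable f) (hg : Computable g) :
    Computable fun a => decide (f a < g a) :=
  (PrimrecRel.decide Primrec.nat_lt).to_comp.comp hf hg

theorem _root_.Computable.sum_range {f : α → ℕ → ℕ} {g : α → ℕ} (hf : Computable₂ f)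
    (hg : Computable g) : Computable fun a => ∑ i ∈ Finset.range (g a), f a i := by
  have : Computable₂ fun (a : α) (p : ℕ × ℕ) => p.2 + f a p.1 :=
    Computable.nat_add' (Computable.snd.comp Computable.snd)
      (hf.comp Computable.fst (Computable.fst.comp Computable.snd))
  refine (Computable.nat_rec hg (Computable.const 0) this).of_eq fun a => ?_
  induction g a with
  | zero => rfl
  | succ n ih => rw [Finset.sum_range_succ, ← ih]

theorem _root_.Computable.sup_range {f : α → ℕ → ℕ} {g : α → ℕ} (hf : Computable₂ f)
    (hg : Computable g) : Computable fun a => (Finset.range (g a)).sup (f a) := by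
  have : Computable₂ fun (a : α) (p : ℕ × ℕ) => max (f a p.1) p.2 :=
    Primrec.nat_max.to_comp.comp (hf.comp Computable.fst (Computable.fst.comp Computable.snd))
      (Computable.snd.comp Computable.snd)
  refine (Computable.nat_rec hg (Computable.const 0) this).of_eq fun a => ?_
  induction g a with
  | zero => rfl
  | succ n ih => rw [Finset.range_add_one, Finset.sup_insert, ← ih]

/-- A partial recursive function is the limit of a computable sequence of its finite stages. -/
theorem _root_.Partrec.exists_stages {Φ : α →. ℕ} (hΦ : Partrec Φ) :
    ∃ ev : ℕ → α → Option ℕ, Computable₂ ev ∧ ∀ a q, q ∈ Φ a ↔ ∃ s, ev s a = some q := by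
  obtain ⟨c, hc⟩ := Nat.Partrec.Code.exists_code.1 hΦ
  refine ⟨fun s a => Nat.Partrec.Code.evaln s c (Encodable.encode a), ?_, fun a q => ?_⟩
  · exact Nat.Partrec.Code.primrec_evaln.to_comp.comp
      (Computable.pair (Computable.pair Computable.fst (Computable.const c))
        (Computable.encode.comp Computable.snd))
  · have := @Nat.Partrec.Code.evaln_complete c (Encodable.encode a) q
    rw [hc] at this
    simpa using this

end Computability

section Strings

@[simp] theorem length_initSeg (X : Cantor) (n : ℕ) : (initSeg X n).length = n := by
  simp [initSeg]

theorem take_initSeg (X : Cantor) {m n : ℕ} (h : m ≤ n) :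
    (initSeg X n).take m = initSeg X m := by
  simp [initSeg, ← List.map_take, List.take_range, h]

theorem mem_basicCyl_initSeg (X : Cantor) (n : ℕ) : X ∈ basicCyl (initSeg X n) := by
  simp [basicCyl]

end Strings

/-- The value `R (X ↾ m) / 2 ^ m` at `X` of the step function of level `m` coded by `R`. -/
noncomputable def stepVal (R : List Bool → ℕ) (X : Cantor) (m : ℕ) : ℝ≥0 :=
  R (initSeg X m) / 2 ^ m

/-! ### Approximation of `t` from below by step functions. -/

section LowerApprox

variable (ev : ℕ → (ℕ × ℕ) × List Bool → Option ℕ)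

/-- The numerator, over `2 ^ |σ|`, of the `e`-th lower bound for the `n`-th function that can be
read off from the string `σ`. -/
def lowerNum (σ : List Bool) (n e : ℕ) : ℕ :=
  -- `e` codes a precision, a stage of `ev` and a prefix length. The `- 1` turns an approximation
  -- into a lower bound; if no output has appeared, the default `0` gives the trivial bound.
  ((ev e.unpair.2.unpair.1 ((n, e.unpair.1), σ.take e.unpair.2.unpair.2)).getD 0 - 1) *
    2 ^ (σ.length - e.unpair.1)

/-- The `e`-th lower bound for the `n`-th function at `X`. -/
noncomputable def lowerVal (X : Cantor) (n e : ℕ) : ℝ≥0 :=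
  (((ev e.unpair.2.unpair.1 ((n, e.unpair.1), initSeg X e.unpair.2.unpair.2)).getD 0 - 1 : ℕ)) /
    2 ^ e.unpair.1

/-- The numerator, over `2 ^ |σ|`, of the lower bound for the sum of all functions that is
available at stage `|σ|`. -/
def sumLowerNum (σ : List Bool) : ℕ :=
  ∑ n ∈ Finset.range (σ.length + 1), (Finset.range (σ.length + 1)).sup (lowerNum ev σ n)

variable {ev}

theorem computable_lowerNum (hev : Computable₂ ev) :
    Computable fun p : (List Bool × ℕ) × ℕ => lowerNum ev p.1.1 p.1.2 p.2 := by
  have he : Computable fun p : (List Bool × ℕ) × ℕ => p.2.unpair :=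
    Computable.unpair.comp Computable.snd
  have he1 : Computable fun p : (List Bool × ℕ) × ℕ => p.2.unpair.1 := Computable.fst.comp he
  have he2 : Computable fun p : (List Bool × ℕ) × ℕ => p.2.unpair.2.unpair :=
    Computable.unpair.comp (Computable.snd.comp he)
  have hσ : Computable fun p : (List Bool × ℕ) × ℕ => p.1.1 := Computable.fst.comp Computable.fst
  have hn : Computable fun p : (List Bool × ℕ) × ℕ => p.1.2 := Computable.snd.comp Computable.fst
  have hval := hev.comp (Computable.fst.comp he2) (Computable.pair (Computable.pair hn he1)
    (Computable.list_take' (Computable.snd.comp he2) hσ))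
  have hnum := (Computable.option_getD hval (Computable.const 0)).nat_sub' (Computable.const 1)
  have hpow := (Computable.const 2).nat_pow' ((Computable.list_length.comp hσ).nat_sub' he1)
  exact (hnum.nat_mul' hpow).of_eq fun p => by rw [lowerNum]

theorem computable_sumLowerNum (hev : Computable₂ ev) : Computable (sumLowerNum ev) := by
  have hlen : Computable fun σ : List Bool => σ.length + 1 :=
    Computable.succ.comp Computable.list_length
  have hsup : Computable₂ fun (σ : List Bool) n =>
      (Finset.range (σ.length + 1)).sup (lowerNum ev σ n) :=
    Computable.sup_range (α := List Bool × ℕ) (f := fun p e => lowerNum ev p.1 p.2 e)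
      (Computable₂.mk (computable_lowerNum hev)) (hlen.comp Computable.fst)
  exact (Computable.sum_range hsup hlen).of_eq fun σ => by rw [sumLowerNum]

/-- All components of the code `e` are at most `e ≤ m`, so the prefix is long enough and the
exponent subtraction is not truncated. -/
theorem lowerNum_initSeg (X : Cantor) {m e : ℕ} (n : ℕ) (h : e ≤ m) :
    (lowerNum ev (initSeg X m) n e : ℝ≥0) / 2 ^ m = lowerVal ev X n e := by
  have h1 : e.unpair.1 ≤ m := (Nat.unpair_left_le e).trans h
  have h2 : e.unpair.2.unpair.2 ≤ m :=
    (Nat.unpair_right_le _).trans ((Nat.unpair_right_le e).trans h)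
  rw [lowerNum, lowerVal, take_initSeg X h2, length_initSeg]
  push_cast
  rw [div_eq_div_iff (by positivity) (by positivity), mul_assoc, ← pow_add, Nat.sub_add_cancel h1]

theorem stepVal_sumLowerNum (X : Cantor) (m : ℕ) :
    stepVal (sumLowerNum ev) X m =
      ∑ n ∈ Finset.range (m + 1), (Finset.range (m + 1)).sup (lowerVal ev X n) := by
  rw [stepVal, sumLowerNum, length_initSeg, Nat.cast_sum, Finset.sum_div]
  refine Finset.sum_congr rfl fun n _ => ?_
  have hmono : Monotone fun a : ℕ => (a : ℝ≥0) / 2 ^ m := fun a b hab => by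
    dsimp only; gcongr
  rw [Finset.apply_sup_eq_sup_comp_of_linearOrder (fun a : ℕ => (a : ℝ≥0) / 2 ^ m) hmono (by simp)]
  refine Finset.sup_congr rfl fun e he => ?_
  exact lowerNum_initSeg X n (Nat.lt_succ_iff.1 (Finset.mem_range.1 he))

theorem monotone_stepVal_sumLowerNum (X : Cantor) :
    Monotone (stepVal (sumLowerNum ev) X) := by
  intro a b hab
  rw [stepVal_sumLowerNum, stepVal_sumLowerNum]
  have hsub : Finset.range (a + 1) ⊆ Finset.range (b + 1) :=
    Finset.range_subset_range.2 (by omega)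
  calc _ ≤ ∑ n ∈ Finset.range (a + 1), (Finset.range (b + 1)).sup (lowerVal ev X n) :=
        Finset.sum_le_sum fun n _ => Finset.sup_mono hsub
    _ ≤ _ := Finset.sum_le_sum_of_subset hsub

end LowerApprox

theorem DyadicApprox.sub_le {x : ℝ≥0} {k q : ℕ} (h : DyadicApprox x k q) :
    ((q - 1 : ℕ) : ℝ≥0) / 2 ^ k ≤ x := by
  have h2 : (0 : ℝ) < 2 ^ k := by positivity
  have h1 := (abs_le.1 h).1
  rw [← NNReal.coe_le_coe, NNReal.coe_div, NNReal.coe_natCast, NNReal.coe_pow, NNReal.coe_ofNat,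
    div_le_iff₀ h2]
  rcases q with _ | q
  · simp
  · field_simp at h1
    push_cast at h1
    rw [Nat.add_sub_cancel]
    linarith

/-- One unit `1 / 2 ^ k` pays for the approximation error, the other for the subtracted `1`. -/
theorem DyadicApprox.le_add {x : ℝ≥0} {k q : ℕ} (h : DyadicApprox x k q) :
    x ≤ ((q - 1 : ℕ) : ℝ≥0) / 2 ^ k + 2 / 2 ^ k := by
  have h2 : (0 : ℝ) < 2 ^ k := by positivity
  have h1 := (abs_le.1 h).2
  have hq : (q : ℝ) ≤ ((q - 1 : ℕ) : ℝ) + 1 := by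
    exact_mod_cast (by omega : q ≤ q - 1 + 1)
  rw [← add_div, ← NNReal.coe_le_coe, NNReal.coe_div, NNReal.coe_add, NNReal.coe_natCast,
    NNReal.coe_pow, NNReal.coe_ofNat, le_div_iff₀ h2]
  field_simp at h1
  linarith

/-- A lower semicomputable function is the supremum of an increasing computable sequence of
dyadic step functions. -/
theorem LowerSemicomputable.exists_stepVal {t : Cantor → ℝ≥0∞} (ht : LowerSemicomputable t) :
    ∃ R : List Bool → ℕ, Computable R ∧ (∀ X, Monotone (stepVal R X)) ∧
      ∀ X, t X = ⨆ m, (stepVal R X m : ℝ≥0∞) := by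
  obtain ⟨g, ⟨Φ, hΦ, hdom, hcor⟩, ht⟩ := ht
  obtain ⟨ev, hev, hstage⟩ := hΦ.exists_stages
  refine ⟨sumLowerNum ev, computable_sumLowerNum hev, monotone_stepVal_sumLowerNum, fun X => ?_⟩
  have hle : ∀ n e, lowerVal ev X n e ≤ g n X := by
    intro n e
    rw [lowerVal]
    rcases h : ev e.unpair.2.unpair.1 ((n, e.unpair.1), initSeg X e.unpair.2.unpair.2) with _ | q
    · simp
    · exact (hcor _ _ _ q ((hstage _ _).2 ⟨_, h⟩) X (mem_basicCyl_initSeg X _)).sub_le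
  have hge : ∀ n k, ∃ e, g n X ≤ lowerVal ev X n e + 2 / 2 ^ k := by
    intro n k
    obtain ⟨l, hl⟩ := hdom n k X
    obtain ⟨s, hs⟩ := (hstage _ _).1 (Part.get_mem hl)
    refine ⟨Nat.pair k (Nat.pair s l), ?_⟩
    simp only [lowerVal, Nat.unpair_pair, hs, Option.getD_some]
    exact (hcor _ _ _ _ (Part.get_mem hl) X (mem_basicCyl_initSeg X _)).le_add
  set w : ℕ → ℕ → ℝ≥0 := fun n m => (Finset.range (m + 1)).sup (lowerVal ev X n) with hw
  have hwmono : ∀ n, Monotone (w n) := fun n a b hab =>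
    Finset.sup_mono (Finset.range_subset_range.2 (by omega))
  have hwle : ∀ n m, w n m ≤ g n X := fun n m => Finset.sup_le fun e _ => hle n e
  have hwsup : ∀ n, (g n X : ℝ≥0∞) ≤ ⨆ m, (w n m : ℝ≥0∞) := by
    intro n
    have hlim : Filter.Tendsto (fun k : ℕ => (⨆ m, (w n m : ℝ≥0∞)) + ((2 / 2 ^ k : ℝ≥0) : ℝ≥0∞))
        Filter.atTop (nhds ((⨆ m, (w n m : ℝ≥0∞)) + 0)) := by
      refine Filter.Tendsto.add tendsto_const_nhds ?_
      rw [← ENNReal.coe_zero, ENNReal.tendsto_coe]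
      have := (NNReal.tendsto_pow_atTop_nhds_zero_of_lt_one
        (show (1 / 2 : ℝ≥0) < 1 from NNReal.half_lt_self one_ne_zero)).const_mul 2
      simpa [div_eq_mul_inv] using this
    rw [add_zero] at hlim
    refine ge_of_tendsto' hlim fun k => ?_
    obtain ⟨e, he⟩ := hge n k
    calc (g n X : ℝ≥0∞) ≤ ((w n e + 2 / 2 ^ k : ℝ≥0) : ℝ≥0∞) := by
          refine ENNReal.coe_le_coe.2 (he.trans ?_)
          gcongr
          exact Finset.le_sup (f := lowerVal ev X n) (Finset.mem_range.2 (Nat.lt_succ_self e))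
      _ ≤ _ := by
          rw [ENNReal.coe_add]
          gcongr
          exact le_iSup (fun m => (w n m : ℝ≥0∞)) e
  have hval : ∀ m, (stepVal (sumLowerNum ev) X m : ℝ≥0∞) =
      ∑ n ∈ Finset.range (m + 1), (w n m : ℝ≥0∞) := fun m => by
    rw [stepVal_sumLowerNum, ENNReal.ofNNReal_finsetSum]
  rw [ht]
  apply le_antisymm
  · rw [ENNReal.tsum_eq_iSup_nat]
    refine iSup_le fun N => ?_
    calc _ ≤ ∑ n ∈ Finset.range N, ⨆ m, (w n m : ℝ≥0∞) := Finset.sum_le_sum fun n _ => hwsup n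
      _ = ⨆ m, ∑ n ∈ Finset.range N, (w n m : ℝ≥0∞) :=
        ENNReal.finsetSum_iSup_of_monotone fun n a b hab => ENNReal.coe_le_coe.2 (hwmono n hab)
      -- Level `max m N` has both enough summands and good enough bounds for each of them.
      _ ≤ _ := iSup_le fun m => le_iSup_of_le (max m N) ?_
    rw [hval]
    calc _ ≤ ∑ n ∈ Finset.range N, (w n (max m N) : ℝ≥0∞) :=
          Finset.sum_le_sum fun n _ => ENNReal.coe_le_coe.2 (hwmono n (le_max_left _ _))
      _ ≤ _ := Finset.sum_le_sum_of_subset (Finset.range_subset_range.2 (by omega))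
  · refine iSup_le fun m => ?_
    rw [hval]
    exact (Finset.sum_le_sum fun n _ => ENNReal.coe_le_coe.2 (hwle n m)).trans
      (ENNReal.sum_le_tsum _)

/-! ### Sums over strings, and the coin measure of cylinders. -/

/-- The list of all binary strings of length `m`. -/
def strings (m : ℕ) : List (List Bool) :=
  Nat.rec [[]] (fun _ L => L.flatMap fun σ => [false :: σ, true :: σ]) m

theorem strings_succ (m : ℕ) :
    strings (m + 1) = (strings m).flatMap fun σ => [false :: σ, true :: σ] := rfl

theorem mem_strings {m : ℕ} {σ : List Bool} : σ ∈ strings m ↔ σ.length = m := by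
  induction m generalizing σ with
  | zero => simp [strings]
  | succ m ih =>
    rw [strings_succ]
    rcases σ with _ | ⟨b, σ⟩
    · simp
    · cases b <;> simp [ih]

theorem nodup_strings (m : ℕ) : (strings m).Nodup := by
  induction m with
  | zero => simp [strings]
  | succ m ih =>
    rw [strings_succ, List.nodup_flatMap]
    refine ⟨fun σ _ => by simp, ih.imp fun {σ τ} h => ?_⟩
    simp [Function.onFun, Ne.symm h]

theorem primrec_strings : Primrec strings := by
  refine Primrec.nat_rec₁ _ (f := fun _ (L : List (List Bool)) => L.flatMap fun σ => [false :: σ, true :: σ]) ?_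
  refine Primrec.list_flatMap Primrec.snd ?_
  have h : ∀ b : Bool, Primrec fun p : (ℕ × List (List Bool)) × List Bool => b :: p.2 := fun b =>
    Primrec.list_cons.comp (Primrec.const b) Primrec.snd
  exact Primrec.list_cons.comp (h false) (Primrec.list_cons.comp (h true) (Primrec.const []))

/-- The sum of `f` over all binary strings of length `m`. -/
def sumStrings (f : List Bool → ℕ) (m : ℕ) : ℕ := ((strings m).map f).sum

theorem sumStrings_eq (f : List Bool → ℕ) (m : ℕ) :
    sumStrings f m = ∑ σ ∈ (strings m).toFinset, f σ := by
  rw [sumStrings, List.sum_toFinset _ (nodup_strings m)]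

/-- Brings list sums into the form to which `Computable.sum_range` applies. -/
theorem _root_.List.sum_map_eq_sum_range {β : Type*} (l : List β) (f : β → ℕ) :
    (l.map f).sum = ∑ i ∈ Finset.range l.length, (l[i]?.map f).getD 0 := by
  induction l with
  | nil => rfl
  | cons a l ih => simp [Finset.sum_range_succ', ih, add_comm]

theorem _root_.Computable.sumStrings {α : Type*} [Primcodable α] {f : α → List Bool → ℕ}
    {g : α → ℕ} (hf : Computable₂ f) (hg : Computable g) :
    Computable fun a => sumStrings (f a) (g a) := by
  have hs : Computable fun a => strings (g a) := primrec_strings.to_comp.comp hg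
  refine (Computable.sum_range (f := fun a i => ((strings (g a))[i]?.map (f a)).getD 0)
    ?_ (Computable.list_length.comp hs)).of_eq fun a => ?_
  · refine Computable.option_getD (Computable.option_map ?_ ?_) (Computable.const 0)
    · exact Computable.list_getElem?.comp (hs.comp Computable.fst) Computable.snd
    · exact hf.comp (Computable.fst.comp Computable.fst) Computable.snd
  · rw [Schnorr.sumStrings, List.sum_map_eq_sum_range]

theorem basicCyl_eq_pi (σ : List Bool) :
    basicCyl σ = Set.pi (Finset.range σ.length) fun i => {σ.getD i false} := by
  ext X
  simp only [basicCyl, initSeg, Set.mem_ofPred_eq, Set.mem_pi, Finset.coe_range, Set.mem_Iio,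
    Set.mem_singleton_iff]
  constructor
  · intro h i hi
    rw [← h]
    simp [List.getD, hi]
  · intro h
    refine List.ext_getElem (by simp) fun i h1 h2 => ?_
    simp [h i h2, List.getD, h2]

theorem measurableSet_basicCyl (σ : List Bool) : MeasurableSet (basicCyl σ) := by
  rw [basicCyl_eq_pi]
  exact MeasurableSet.pi (Finset.countable_toSet _) fun _ _ => MeasurableSet.singleton _

instance : IsProbabilityMeasure coin := by
  unfold coin; infer_instance

theorem coin_basicCyl (σ : List Bool) : coin (basicCyl σ) = (2 ^ σ.length)⁻¹ := by
  rw [basicCyl_eq_pi, coin, Measure.infinitePi_pi _ fun _ _ => MeasurableSet.singleton _]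
  simp [ENNReal.inv_pow]

theorem initSeg_eq_iff {X : Cantor} {σ : List Bool} {m : ℕ} (h : σ.length = m) :
    initSeg X m = σ ↔ X ∈ basicCyl σ := by
  subst h; rfl

/-- The cylinders of length `m` partition the space, so only one term survives; measurability and
integrals thereby reduce to cylinders. -/
theorem comp_initSeg_eq_sum {M : Type*} [AddCommMonoid M] (F : List Bool → M) (m : ℕ)
    (X : Cantor) : F (initSeg X m) =
      ∑ σ ∈ (strings m).toFinset, (basicCyl σ).indicator (fun _ => F σ) X := by
  rw [Finset.sum_eq_single (initSeg X m)]
  · rw [Set.indicator_of_mem (mem_basicCyl_initSeg X m)]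
  · intro σ hσ hne
    refine Set.indicator_of_notMem (fun hX => hne ?_) _
    exact ((initSeg_eq_iff (mem_strings.1 (List.mem_toFinset.1 hσ))).2 hX).symm
  · intro h
    exact absurd (List.mem_toFinset.2 (mem_strings.2 (length_initSeg X m))) h

theorem measurable_comp_initSeg (F : List Bool → ℝ≥0∞) (m : ℕ) :
    Measurable fun X => F (initSeg X m) := by
  simp only [fun X => comp_initSeg_eq_sum F m X]
  exact Finset.measurable_fun_sum _ fun σ _ =>
    measurable_const.indicator (measurableSet_basicCyl σ)

theorem lintegral_comp_initSeg (f : List Bool → ℕ) (m : ℕ) :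
    ∫⁻ X, (f (initSeg X m) : ℝ≥0∞) ∂coin = sumStrings f m / 2 ^ m := by
  simp only [fun X => comp_initSeg_eq_sum (fun σ => (f σ : ℝ≥0∞)) m X]
  rw [lintegral_finsetSum _ fun σ _ => measurable_const.indicator (measurableSet_basicCyl σ),
    sumStrings_eq, Nat.cast_sum, div_eq_mul_inv, Finset.sum_mul]
  refine Finset.sum_congr rfl fun σ hσ => ?_
  rw [lintegral_indicator_const (measurableSet_basicCyl σ), coin_basicCyl,
    mem_strings.1 (List.mem_toFinset.1 hσ)]

theorem measurableSet_initSeg (p : List Bool → Prop) (m : ℕ) :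
    MeasurableSet {X : Cantor | p (initSeg X m)} := by
  classical
  have := measurable_comp_initSeg (fun σ => if p σ then 1 else 0) m (measurableSet_singleton 1)
  convert this using 1
  ext X
  simp

theorem coin_setOf_initSeg (p : List Bool → Bool) (m : ℕ) :
    coin {X | p (initSeg X m) = true} =
      (sumStrings (fun σ => (p σ).toNat) m : ℝ≥0∞) / 2 ^ m := by
  rw [← lintegral_comp_initSeg, ← lintegral_indicator_one (measurableSet_initSeg (p · = true) m)]
  refine lintegral_congr fun X => ?_
  by_cases h : p (initSeg X m) <;> simp [h]

theorem measurable_stepVal (R : List Bool → ℕ) (m : ℕ) :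
    Measurable fun X => (stepVal R X m : ℝ≥0∞) :=
  measurable_comp_initSeg (fun σ => ((R σ / 2 ^ m : ℝ≥0) : ℝ≥0∞)) m

/-- The denominator `4 ^ m` combines the `2 ^ m` of `stepVal` with the measure `2 ^ (-m)` of each
cylinder. -/
theorem lintegral_stepVal (R : List Bool → ℕ) (m : ℕ) :
    ∫⁻ X, (stepVal R X m : ℝ≥0∞) ∂coin = ((sumStrings R m / 4 ^ m : ℝ≥0) : ℝ≥0∞) := by
  have h : ∀ X, (stepVal R X m : ℝ≥0∞) = (R (initSeg X m) : ℝ≥0∞) * (2 ^ m)⁻¹ := fun X => by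
    rw [stepVal, ENNReal.coe_div (by positivity), div_eq_mul_inv]
    simp
  simp only [h]
  rw [lintegral_mul_const _ (measurable_comp_initSeg (fun σ => (R σ : ℝ≥0∞)) m),
    lintegral_comp_initSeg, ENNReal.coe_div (by positivity), div_eq_mul_inv, div_eq_mul_inv,
    mul_assoc, ← ENNReal.mul_inv (by simp) (by simp), ← mul_pow]
  norm_num

/-- Rounding a lower bound whose error is at most `2 ^ (-p)` to a dyadic approximation. -/
theorem dyadicApprox_round {x : ℝ≥0} {c M p : ℕ} (h1 : (c : ℝ≥0) / 2 ^ M ≤ x)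
    (h2 : x ≤ (c : ℝ≥0) / 2 ^ M + (2 ^ p)⁻¹) : DyadicApprox x p (c * 2 ^ p / 2 ^ M + 1) := by
  rw [← NNReal.coe_le_coe] at h1 h2
  push_cast at h1 h2
  have hM : (0 : ℝ) < 2 ^ M := by positivity
  have hp : (0 : ℝ) < 2 ^ p := by positivity
  -- Rounding down loses less than one unit `2 ^ (-p)`, so after adding `1` the output lies, like
  -- `x`, in an interval of length `2 ^ (-p)` starting at `c / 2 ^ M`.
  have a1 : ((c * 2 ^ p / 2 ^ M : ℕ) : ℝ) ≤ c * 2 ^ p / 2 ^ M := by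
    simpa using (Nat.cast_div_le (α := ℝ) (m := c * 2 ^ p) (n := 2 ^ M))
  have a2 : (c : ℝ) * 2 ^ p / 2 ^ M ≤ ((c * 2 ^ p / 2 ^ M : ℕ) : ℝ) + 1 := by
    rw [div_le_iff₀ hM]
    have := (Nat.lt_mul_div_succ (c * 2 ^ p) (b := 2 ^ M) (by positivity)).le
    rw [mul_comm (2 ^ M)] at this
    exact_mod_cast this
  have e1 : (c : ℝ) * 2 ^ p / 2 ^ M = c / 2 ^ M * 2 ^ p := by ring
  rw [e1] at a1 a2
  rw [DyadicApprox, abs_le, neg_le_sub_iff_le_add, sub_le_iff_le_add]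
  push_cast
  rw [add_div, one_div]
  generalize (c : ℝ) / 2 ^ M = y at *
  rw [← le_div_iff₀ hp] at a2
  rw [← div_le_iff₀ hp] at a1
  rw [add_div, one_div] at a2
  constructor <;> linarith

/-- Unbounded search for a witness of a computable relation is computable. -/
theorem _root_.Computable.exists_search {α : Type*} [Primcodable α] {p : α → ℕ → Bool}
    (hp : Computable₂ p) (h : ∀ a, ∃ n, p a n = true) :
    ∃ f : α → ℕ, Computable f ∧ ∀ a, p a (f a) = true := by
  have hmem : ∀ a, ∃ n, n ∈ Nat.rfind (p a : ℕ →. Bool) := fun a => by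
    obtain ⟨n, hn⟩ := h a
    obtain ⟨m, hm, -⟩ := Nat.rfind_min' hn
    exact ⟨m, hm⟩
  choose f hf using hmem
  refine ⟨f, (Partrec.rfind hp.partrec₂).of_eq_tot hf, fun a => ?_⟩
  simpa using Nat.rfind_spec (hf a)

/-- The left side is the decidable form, in integers, of the test used to search for levels. -/
theorem add_one_mul_pow_le_iff (a S m k : ℕ) :
    (a + 1) * 4 ^ m ≤ S * 4 ^ (k + 1) + 4 * 4 ^ m ↔
      ((a : ℝ) + 1) / 4 ^ (k + 1) ≤ S / 4 ^ m + (4 ^ k)⁻¹ := by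
  have hA : (0 : ℝ) < 4 ^ m := by positivity
  have hB : (0 : ℝ) < 4 ^ (k + 1) := by positivity
  have hk : ((4 : ℝ) ^ k)⁻¹ = 4 / 4 ^ (k + 1) := by
    rw [pow_succ]; field_simp
  rw [hk, div_add_div _ _ hA.ne' hB.ne', div_le_div_iff₀ hB (by positivity), ← mul_assoc,
    mul_le_mul_iff_of_pos_right hB, mul_comm _ (4 : ℝ), ← Nat.cast_le (α := ℝ)]
  push_cast
  rfl

/-! ### Levels with fast convergence of the integrals. -/

section Levels

variable {R : List Bool → ℕ} {t : Cantor → ℝ≥0∞} {I : ℝ≥0}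

theorem lintegral_eq_iSup (hmono : ∀ X, Monotone (stepVal R X))
    (ht : ∀ X, t X = ⨆ m, (stepVal R X m : ℝ≥0∞)) :
    ∫⁻ X, t X ∂coin = ⨆ m, ∫⁻ X, (stepVal R X m : ℝ≥0∞) ∂coin := by
  simp only [ht]
  exact lintegral_iSup (fun m => measurable_stepVal R m)
    fun a b hab X => ENNReal.coe_le_coe.2 (hmono X hab)

theorem monotone_sumStrings_div (hmono : ∀ X, Monotone (stepVal R X)) :
    Monotone fun m => (sumStrings R m / 4 ^ m : ℝ≥0) := fun a b hab => by
  dsimp only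
  rw [← ENNReal.coe_le_coe, ← lintegral_stepVal, ← lintegral_stepVal]
  exact lintegral_mono fun X => ENNReal.coe_le_coe.2 (hmono X hab)

theorem tendsto_sumStrings_div (hmono : ∀ X, Monotone (stepVal R X))
    (ht : ∀ X, t X = ⨆ m, (stepVal R X m : ℝ≥0∞)) (htI : ∫⁻ X, t X ∂coin = (I : ℝ≥0∞)) :
    Filter.Tendsto (fun m => (sumStrings R m / 4 ^ m : ℝ≥0)) Filter.atTop (nhds I) := by
  rw [← ENNReal.tendsto_coe, ← htI, lintegral_eq_iSup hmono ht]
  simp only [lintegral_stepVal]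
  exact tendsto_atTop_iSup fun a b hab =>
    ENNReal.coe_le_coe.2 (monotone_sumStrings_div hmono hab)

/-- If the integral is computable, then one can compute levels at which the integrals of the
step functions converge fast. -/
theorem exists_levels (hR : Computable R) (hmono : ∀ X, Monotone (stepVal R X))
    (ht : ∀ X, t X = ⨆ m, (stepVal R X m : ℝ≥0∞)) (hI : ComputableNNReal I)
    (htI : ∫⁻ X, t X ∂coin = (I : ℝ≥0∞)) :
    ∃ M : ℕ → ℕ, Computable M ∧ StrictMono M ∧
      ∀ k, I ≤ sumStrings R (M k) / 4 ^ M k + (4 ^ k)⁻¹ := by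
  obtain ⟨a, ha, haI⟩ := hI
  have hp : Computable₂ fun k m => decide
      ((a (2 * k + 2) + 1) * 4 ^ m ≤ sumStrings R m * 4 ^ (k + 1) + 4 * 4 ^ m) := by
    have hk : Computable fun p : ℕ × ℕ => p.1 := Computable.fst
    have hm : Computable fun p : ℕ × ℕ => p.2 := Computable.snd
    have h4m := (Computable.const 4).nat_pow' hm
    have hS : Computable fun p : ℕ × ℕ => sumStrings R p.2 :=
      Computable.sumStrings (f := fun _ => R) (hR.comp Computable.snd) hm
    have hak := ha.comp (((Computable.const 2).nat_mul' hk).nat_add' (Computable.const 2))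
    exact Computable.decide_le ((hak.nat_add' (Computable.const 1)).nat_mul' h4m)
      ((hS.nat_mul' ((Computable.const 4).nat_pow' (hk.nat_add' (Computable.const 1)))).nat_add'
        ((Computable.const 4).nat_mul' h4m))
  have hex : ∀ k, ∃ m, decide
      ((a (2 * k + 2) + 1) * 4 ^ m ≤ sumStrings R m * 4 ^ (k + 1) + 4 * 4 ^ m) = true := by
    intro k
    -- The precision `2 * k + 2` has unit `4 ^ (-(k + 1))`. Of the four units in `4 ^ (-k)`, two
    -- cover the excess of `a + 1` over `I` and two are slack for the limit.
    have hlim := (tendsto_sumStrings_div hmono ht htI).add_const (2 / 4 ^ (k + 1) : ℝ≥0)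
    have hlt : I < I + 2 / 4 ^ (k + 1) := lt_add_of_pos_right _ (by positivity)
    obtain ⟨m, hm⟩ := (hlim.eventually (lt_mem_nhds hlt)).exists
    refine ⟨m, decide_eq_true ?_⟩
    have h1 := (abs_le.1 (haI (2 * k + 2))).1
    rw [← NNReal.coe_lt_coe] at hm
    push_cast at hm
    rw [show 2 * k + 2 = 2 * (k + 1) by ring, pow_mul, show (2 : ℝ) ^ 2 = 4 by norm_num] at h1
    rw [show 2 * k + 2 = 2 * (k + 1) by ring, add_one_mul_pow_le_iff, add_div, one_div]
    have h2 : ((4 : ℝ) ^ k)⁻¹ = 2 / 4 ^ (k + 1) + 2 * (4 ^ (k + 1))⁻¹ := by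
      rw [pow_succ]; field_simp; norm_num
    linarith
  obtain ⟨m, hm, hmp⟩ := Computable.exists_search hp hex
  have hbound : ∀ k, I ≤ sumStrings R (m k) / 4 ^ m k + (4 ^ k)⁻¹ := by
    intro k
    have h0 := of_decide_eq_true (hmp k)
    have h1 := (abs_le.1 (haI (2 * k + 2))).2
    rw [show 2 * k + 2 = 2 * (k + 1) by ring] at h0 h1
    rw [pow_mul, show (2 : ℝ) ^ 2 = 4 by norm_num] at h1
    rw [add_one_mul_pow_le_iff, add_div, one_div] at h0
    rw [← NNReal.coe_le_coe]
    push_cast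
    linarith
  -- The levels found need not increase. The sums of `m i + 1` do, and as they dominate `m k` (up to
  -- the start `m 0`), the bound persists.
  refine ⟨fun k => Nat.rec (m 0) (fun k acc => acc + (m (k + 1) + 1)) k, ?_, ?_, fun k => ?_⟩
  · refine Computable.nat_rec (h := fun _ p => p.2 + (m (p.1 + 1) + 1)) Computable.id
      (Computable.const _) ?_
    have h1 : Computable fun p : ℕ × ℕ × ℕ => p.2.1 := Computable.fst.comp Computable.snd
    exact (Computable.snd.comp Computable.snd).nat_add'
      ((hm.comp (h1.nat_add' (Computable.const 1))).nat_add' (Computable.const 1))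
  · exact strictMono_nat_of_lt_succ fun k => by dsimp only; omega
  · refine (hbound k).trans ?_
    gcongr ?_ + _
    refine monotone_sumStrings_div hmono ?_
    cases k with
    | zero => exact le_rfl
    | succ k => dsimp only; omega

end Levels

/-! ### Large jumps and the Schnorr test. -/

section Jump

variable (R : List Bool → ℕ) (M : ℕ → ℕ)

/-- Whether the step function of level `M (k + 1)` exceeds that of level `M k` by more than
`2 ^ (-k)` on the string `σ`. -/
def jump (σ : List Bool) (k : ℕ) : Bool :=
  -- Denominators are cleared by the factor `2 ^ (M k + M (k + 1) + k)`.
  decide (R (σ.take (M k)) * 2 ^ M (k + 1) * 2 ^ k + 2 ^ M k * 2 ^ M (k + 1) <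
    R (σ.take (M (k + 1))) * 2 ^ M k * 2 ^ k)

/-- The set of `X` at which the `k`-th jump is large. -/
def jumpSet (k : ℕ) : Set Cantor := {X | jump R M (initSeg X (M (k + 1))) k = true}

variable {R M}

theorem computable_jump (hR : Computable R) (hM : Computable M) : Computable₂ (jump R M) := by
  have hσ : Computable fun p : List Bool × ℕ => p.1 := Computable.fst
  have hk : Computable fun p : List Bool × ℕ => p.2 := Computable.snd
  have hMk := hM.comp hk
  have hMk' := hM.comp (Computable.succ.comp hk)
  have h2 : Computable fun _ : List Bool × ℕ => 2 := Computable.const 2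
  have hRk := hR.comp (Computable.list_take' hMk hσ)
  have hRk' := hR.comp (Computable.list_take' hMk' hσ)
  have hk2 := h2.nat_pow' hk
  have hM2 := h2.nat_pow' hMk
  have hM2' := h2.nat_pow' hMk'
  exact (Computable.decide_lt (((hRk.nat_mul' hM2').nat_mul' hk2).nat_add' (hM2.nat_mul' hM2'))
    ((hRk'.nat_mul' hM2).nat_mul' hk2)).of_eq fun p => rfl

theorem jump_initSeg (hM : StrictMono M) (X : Cantor) {k l : ℕ} (h : M (k + 1) ≤ l) :
    jump R M (initSeg X l) k = true ↔ X ∈ jumpSet R M k := by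
  have hk : M k ≤ M (k + 1) := hM.monotone k.le_succ
  simp only [jumpSet, Set.mem_ofPred_eq, jump, take_initSeg X (hk.trans h), take_initSeg X h,
    take_initSeg X hk, take_initSeg X le_rfl]

theorem mem_jumpSet (hM : StrictMono M) {X : Cantor} {k : ℕ} :
    X ∈ jumpSet R M k ↔ stepVal R X (M k) + (2 ^ k)⁻¹ < stepVal R X (M (k + 1)) := by
  have hk : M k ≤ M (k + 1) := hM.monotone k.le_succ
  simp only [jumpSet, Set.mem_ofPred_eq, jump, take_initSeg X hk, take_initSeg X le_rfl,
    decide_eq_true_eq, stepVal]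
  rw [← one_div, div_add_div _ _ (by positivity) (by positivity), div_lt_div_iff₀ (by positivity)
    (by positivity), ← Nat.cast_lt (α := ℝ≥0)]
  push_cast
  constructor <;> intro h <;> convert h using 1 <;> ring

theorem measurableSet_jumpSet (k : ℕ) : MeasurableSet (jumpSet R M k) :=
  measurableSet_initSeg (fun σ => jump R M σ k = true) _

/-- Markov's inequality: `2 ^ (-k)` times the measure is at most the gain of integral above level `M
k`, which is at most `4 ^ (-k)`. -/
theorem coin_jumpSet_le {I : ℝ≥0} (hM : StrictMono M) (hmono : ∀ X, Monotone (stepVal R X))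
    (hIle : ∀ m, ∫⁻ X, (stepVal R X m : ℝ≥0∞) ∂coin ≤ I)
    (hI : ∀ k, I ≤ sumStrings R (M k) / 4 ^ M k + (4 ^ k)⁻¹) (k : ℕ) :
    coin (jumpSet R M k) ≤ (2 ^ k)⁻¹ := by
  have h1 : ∫⁻ X, (stepVal R X (M k) : ℝ≥0∞) ∂coin + (2 ^ k)⁻¹ * coin (jumpSet R M k) ≤
      ∫⁻ X, (stepVal R X (M k) : ℝ≥0∞) ∂coin + (4 ^ k)⁻¹ := by
    calc _ = ∫⁻ X, ((stepVal R X (M k) : ℝ≥0∞) +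
            (jumpSet R M k).indicator (fun _ => (2 ^ k)⁻¹) X) ∂coin := by
          rw [lintegral_add_left (measurable_stepVal R _),
            lintegral_indicator_const (measurableSet_jumpSet k)]
      _ ≤ ∫⁻ X, (stepVal R X (M (k + 1)) : ℝ≥0∞) ∂coin := by
          refine lintegral_mono fun X => ?_
          by_cases hX : X ∈ jumpSet R M k
          · rw [Set.indicator_of_mem hX]
            have := ENNReal.coe_le_coe.2 ((mem_jumpSet hM).1 hX).le
            rw [ENNReal.coe_add, ENNReal.coe_inv (by positivity)] at this
            simpa using this
          · rw [Set.indicator_of_notMem hX, add_zero]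
            exact ENNReal.coe_le_coe.2 (hmono X (hM.monotone k.le_succ))
      _ ≤ I := hIle _
      _ ≤ _ := by
          rw [lintegral_stepVal]
          have := ENNReal.coe_le_coe.2 (hI k)
          rw [ENNReal.coe_add, ENNReal.coe_inv (by positivity)] at this
          simpa using this
  have h2 := (ENNReal.add_le_add_iff_left (by rw [lintegral_stepVal]; exact ENNReal.coe_ne_top)).1 h1
  calc coin (jumpSet R M k) = 2 ^ k * ((2 ^ k)⁻¹ * coin (jumpSet R M k)) := by
        rw [← mul_assoc, ENNReal.mul_inv_cancel (by simp) (by simp), one_mul]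
    _ ≤ 2 ^ k * (4 ^ k)⁻¹ := by gcongr
    _ = (2 ^ k)⁻¹ := by
        rw [show (4 : ℝ≥0∞) = 2 * 2 by norm_num, mul_pow,
          ENNReal.mul_inv (by simp) (by simp), ← mul_assoc,
          ENNReal.mul_inv_cancel (by simp) (by simp), one_mul]

theorem coin_iUnion_jumpSet_le (hV : ∀ k, coin (jumpSet R M k) ≤ (2 ^ k)⁻¹) (n : ℕ) :
    coin (⋃ k, jumpSet R M (n + 1 + k)) ≤ (2 ^ n)⁻¹ := by
  calc _ ≤ ∑' k, coin (jumpSet R M (n + 1 + k)) := measure_iUnion_le _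
    _ ≤ ∑' k, (2 ^ n)⁻¹ * (2⁻¹ : ℝ≥0∞) ^ (k + 1) := by
        refine ENNReal.tsum_le_tsum fun k => (hV _).trans_eq ?_
        rw [add_assoc, add_comm 1 k, pow_add, ENNReal.mul_inv (by simp) (by simp), ENNReal.inv_pow,
          ENNReal.inv_pow]
    _ = (2 ^ n)⁻¹ := by
        rw [ENNReal.tsum_mul_left, ENNReal.tsum_geometric_add_one, ENNReal.one_sub_inv_two,
          inv_inv, ENNReal.inv_mul_cancel (by simp) (by simp), mul_one]

/-- The large jumps from the index `n + 1` on form a Schnorr test. -/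
theorem isSchnorrTest_jumpSet (hR : Computable R) (hMc : Computable M) (hM : StrictMono M)
    (hV : ∀ k, coin (jumpSet R M k) ≤ (2 ^ k)⁻¹) :
    IsSchnorrTest fun n => ⋃ k, jumpSet R M (n + 1 + k) := by
  have hj := computable_jump hR hMc
  -- `s` codes an offset `k` and a string; the string is enumerated if it is long enough to decide
  -- the jump and shows it.
  refine ⟨⟨⟨fun n s => (Encodable.decode (α := List Bool) s.unpair.2).bind fun σ =>
    bif decide (M (n + 1 + s.unpair.1 + 1) ≤ σ.length) then
      bif jump R M σ (n + 1 + s.unpair.1) then some σ else none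
    else none, ?_, fun n => ?_⟩, coin_iUnion_jumpSet_le hV⟩, ?_⟩
  · have hs : Computable fun p : ℕ × ℕ => p.2.unpair := Computable.unpair.comp Computable.snd
    refine Computable.option_bind (Computable.decode.comp (Computable.snd.comp hs)) ?_
    have hi : Computable fun p : (ℕ × ℕ) × List Bool => p.1.1 + 1 + p.1.2.unpair.1 :=
      ((Computable.fst.comp Computable.fst).nat_add' (Computable.const 1)).nat_add'
        ((Computable.fst.comp hs).comp Computable.fst)
    exact Computable.cond (Computable.decide_le (hMc.comp (hi.nat_add' (Computable.const 1)))
        (Computable.list_length.comp Computable.snd))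
      (Computable.cond (hj.comp Computable.snd hi) (Computable.option_some.comp Computable.snd)
        (Computable.const none)) (Computable.const none)
  · ext X
    simp only [Set.mem_iUnion]
    constructor
    · rintro ⟨k, hk⟩
      refine ⟨Nat.pair k (Encodable.encode (initSeg X (M (n + 1 + k + 1)))), ?_⟩
      have hk' : jump R M (initSeg X (M (n + 1 + k + 1))) (n + 1 + k) = true := hk
      simp [Encodable.encodek, hk', basicOpen, mem_basicCyl_initSeg]
    · rintro ⟨s, hs⟩
      rcases hd : Encodable.decode (α := List Bool) s.unpair.2 with _ | σ
      · simp [hd, basicOpen] at hs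
      · by_cases hl : M (n + 1 + s.unpair.1 + 1) ≤ σ.length
        · by_cases hv : jump R M σ (n + 1 + s.unpair.1) = true
          · simp only [hd, Option.bind_some, hl, decide_true, hv, cond_true, basicOpen] at hs
            refine ⟨s.unpair.1, (jump_initSeg hM X hl).1 ?_⟩
            rwa [(initSeg_eq_iff rfl).2 hs]
          · simp [hd, hv, basicOpen] at hs
        · simp [hd, hl, basicOpen] at hs
  -- The first `p` jump sets are decided by strings of length `M (n + 1 + p)`, so the measure of
  -- their union is a count. The rest has measure at most `2 ^ (-(n + p))`.
  · let any : ℕ × ℕ → List Bool → Bool := fun a σ =>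
      decide (0 < ∑ k ∈ Finset.range a.2, (jump R M σ (a.1 + 1 + k)).toNat)
    have hany : Computable₂ any := by
      refine Computable.decide_lt (Computable.const 0)
        (Computable.sum_range (α := (ℕ × ℕ) × List Bool) (f := fun p k => (jump R M p.2 (p.1.1 + 1 + k)).toNat) ?_
          (Computable.snd.comp Computable.fst))
      have h1 : Computable fun p : ((ℕ × ℕ) × List Bool) × ℕ =>
          jump R M p.1.2 (p.1.1.1 + 1 + p.2) :=
        hj.comp (Computable.snd.comp Computable.fst)
          (((Computable.fst.comp (Computable.fst.comp Computable.fst)).nat_add'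
            (Computable.const 1)).nat_add' Computable.snd)
      exact (Primrec.dom_finite Bool.toNat).to_comp.comp h1
    have hlev : Computable fun a : ℕ × ℕ => M (a.1 + 1 + a.2) :=
      hMc.comp ((Computable.fst.nat_add' (Computable.const 1)).nat_add' Computable.snd)
    have h2 : Computable fun _ : ℕ × ℕ => 2 := Computable.const 2
    refine ⟨fun n p => sumStrings (fun σ => (any (n, p) σ).toNat) (M (n + 1 + p)) * 2 ^ p /
      2 ^ M (n + 1 + p) + 1, ?_, fun n p => ?_⟩
    · have hsum : Computable fun a : ℕ × ℕ =>
          sumStrings (fun σ => (any a σ).toNat) (M (a.1 + 1 + a.2)) :=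
        Computable.sumStrings (f := fun a σ => (any a σ).toNat)
          ((Primrec.dom_finite Bool.toNat).to_comp.comp hany) hlev
      exact ((hsum.nat_mul' (h2.nat_pow' Computable.snd)).nat_div' (h2.nat_pow' hlev)).nat_add'
        (Computable.const 1)
    · have hset : {X | any (n, p) (initSeg X (M (n + 1 + p))) = true} =
          ⋃ k ∈ Finset.range p, jumpSet R M (n + 1 + k) := by
        ext X
        simp only [any, Set.mem_ofPred_eq, decide_eq_true_eq, Set.mem_iUnion, Finset.sum_pos_iff,
          exists_prop]
        refine exists_congr fun k => and_congr_right fun hk => ?_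
        rw [Nat.pos_iff_ne_zero, Ne, Bool.toNat_eq_zero, Bool.not_eq_false, jump_initSeg hM]
        exact hM.monotone (by have := Finset.mem_range.1 hk; omega)
      have hfin : ((sumStrings (fun σ => (any (n, p) σ).toNat) (M (n + 1 + p)) /
          2 ^ M (n + 1 + p) : ℝ≥0) : ℝ≥0∞) =
            coin (⋃ k ∈ Finset.range p, jumpSet R M (n + 1 + k)) := by
        rw [← hset, coin_setOf_initSeg, ENNReal.coe_div (by positivity)]
        simp
      refine dyadicApprox_round ?_ ?_
      · rw [← ENNReal.coe_le_coe, hfin, ENNReal.coe_toNNReal (measure_ne_top _ _)]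
        exact measure_mono (Set.iUnion₂_subset fun k _ =>
          Set.subset_iUnion (fun k => jumpSet R M (n + 1 + k)) k)
      · rw [← ENNReal.coe_le_coe, ENNReal.coe_add, hfin, ENNReal.coe_toNNReal (measure_ne_top _ _)]
        have hsub : (⋃ k, jumpSet R M (n + 1 + k)) ⊆
            (⋃ k ∈ Finset.range p, jumpSet R M (n + 1 + k)) ∪
              ⋃ k, jumpSet R M (n + p + 1 + k) := by
          refine Set.iUnion_subset fun k X hX => ?_
          by_cases hk : k < p
          · exact Or.inl (Set.mem_iUnion₂.2 ⟨k, Finset.mem_range.2 hk, hX⟩)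
          · refine Or.inr (Set.mem_iUnion.2 ⟨k - p, ?_⟩)
            rwa [show n + p + 1 + (k - p) = n + 1 + k by omega]
        refine (measure_mono hsub).trans ((measure_union_le _ _).trans ?_)
        gcongr
        refine (coin_iUnion_jumpSet_le hV (n + p)).trans ?_
        rw [ENNReal.coe_inv (by positivity)]
        push_cast
        gcongr
        · norm_num
        · omega

end Jump

/-! ### Climbing until the first obstacle. -/

/-- The index reached from `n` after `j` attempts to go up by one, where `b` says at which indices
one gets stuck. -/
def climb (b : ℕ → Bool) (n j : ℕ) : ℕ :=
  Nat.rec n (fun _ k => bif b k then k else k + 1) j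

theorem climb_succ (b : ℕ → Bool) (n j : ℕ) :
    climb b n (j + 1) = bif b (climb b n j) then climb b n j else climb b n j + 1 := rfl

theorem climb_le (b : ℕ → Bool) (n j : ℕ) : climb b n j ≤ n + j := by
  induction j with
  | zero => exact le_rfl
  | succ j ih => rw [climb_succ]; cases b (climb b n j) <;> simp <;> omega

theorem climb_congr {b b' : ℕ → Bool} {n j : ℕ} (h : ∀ k < n + j, b k = b' k) :
    climb b n j = climb b' n j := by
  induction j with
  | zero => rfl
  | succ j ih =>
    have hj := ih fun k hk => h k (by omega)
    rw [climb_succ, climb_succ, hj, h _ (by have := climb_le b' n j; omega)]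

/-- Being stuck is permanent, so a climb that is not stuck has succeeded at every attempt. -/
theorem climb_stuck_or (b : ℕ → Bool) (n j : ℕ) :
    b (climb b n j) = true ∨ climb b n j = n + j := by
  induction j with
  | zero => exact Or.inr rfl
  | succ j ih =>
    rcases h : b (climb b n j) with _ | _
    · right
      have := ih.resolve_left (by simp [h])
      rw [climb_succ, h, this]
      rfl
    · left
      rw [climb_succ, h]
      exact h

theorem climb_of_forall_false {b : ℕ → Bool} {n : ℕ} (h : ∀ k, n ≤ k → b k = false) (j : ℕ) :
    climb b n j = n + j :=
  (climb_stuck_or b n j).resolve_left fun hb => by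
    have hle : n ≤ climb b n j := by
      clear hb
      induction j with
      | zero => exact le_rfl
      | succ j ih => rw [climb_succ]; cases b (climb b n j) <;> simp <;> omega
    simp [h _ hle] at hb

theorem _root_.Computable.climb {α : Type*} [Primcodable α] {b : α → ℕ → Bool} {n j : α → ℕ}
    (hb : Computable₂ b) (hn : Computable n) (hj : Computable j) :
    Computable fun a => climb (b a) (n a) (j a) := by
  refine Computable.nat_rec (h := fun a p => bif b a p.2 then p.2 else p.2 + 1) hj hn ?_
  have h2 : Computable fun p : α × ℕ × ℕ => p.2.2 := Computable.snd.comp Computable.snd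
  exact Computable.cond (hb.comp Computable.fst h2) h2 (Computable.succ.comp h2)

/-! ### The stopped limits and their computability. -/

section Limit

variable (R : List Bool → ℕ) (M : ℕ → ℕ)

/-- The index reached from `n` after `j` attempts to go up by one without a large jump at `X`. -/
def climbAt (X : Cantor) (n j : ℕ) : ℕ :=
  climb (fun k => jump R M (initSeg X (M (k + 1))) k) n j

/-- The limit, along the levels `M n, M (n + 1), …`, of the step functions up to the first large
jump. -/
noncomputable def stoppedLimit (n : ℕ) (X : Cantor) : ℝ≥0 :=
  ⨆ j, stepVal R X (M (climbAt R M X n j))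

variable {R M}

theorem climb_jump_initSeg (hM : StrictMono M) (X : Cantor) {n j l : ℕ} (h : M (n + j) ≤ l) :
    climb (jump R M (initSeg X l)) n j = climbAt R M X n j :=
  climb_congr fun k hk => Bool.eq_iff_iff.2
    (jump_initSeg hM X ((hM.monotone (by omega : k + 1 ≤ n + j)).trans h))

theorem monotone_stepVal_climbAt (hM : StrictMono M) (hmono : ∀ X, Monotone (stepVal R X))
    (n : ℕ) (X : Cantor) : Monotone fun j => stepVal R X (M (climbAt R M X n j)) := by
  refine monotone_nat_of_le_succ fun j => hmono X (hM.monotone ?_)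
  rw [climbAt, climbAt, climb_succ]
  cases jump R M _ _ <;> simp

/-- The index moves only if no attempt has failed; it is then `n + j`, and the absence of a large
jump bounds the increment by `2 ^ (-(n + j))`. -/
theorem stepVal_climbAt_succ_le (hM : StrictMono M) (n : ℕ) (X : Cantor) (j : ℕ) :
    stepVal R X (M (climbAt R M X n (j + 1))) ≤
      stepVal R X (M (climbAt R M X n j)) + (2 ^ j)⁻¹ := by
  have hs : climbAt R M X n (j + 1) = bif jump R M (initSeg X (M (climbAt R M X n j + 1)))
    (climbAt R M X n j) then climbAt R M X n j else climbAt R M X n j + 1 := climb_succ _ _ _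
  rcases h : jump R M (initSeg X (M (climbAt R M X n j + 1))) (climbAt R M X n j) with _ | _
  · rw [hs, h, cond_false]
    have hnj : climbAt R M X n j = n + j :=
      (climb_stuck_or _ n j).resolve_left fun hb => by
        rw [← climbAt, h] at hb
        exact Bool.false_ne_true hb
    have hX : X ∉ jumpSet R M (climbAt R M X n j) := by
      intro hX
      rw [jumpSet, Set.mem_ofPred_eq, h] at hX
      exact Bool.false_ne_true hX
    rw [mem_jumpSet hM, not_lt] at hX
    refine hX.trans ?_
    gcongr
    · exact one_le_two
    · omega
  · rw [hs, h, cond_true]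
    exact le_self_add

theorem stepVal_climbAt_le (hM : StrictMono M) (hmono : ∀ X, Monotone (stepVal R X))
    (n : ℕ) (X : Cantor) (i j : ℕ) :
    stepVal R X (M (climbAt R M X n i)) ≤
      stepVal R X (M (climbAt R M X n j)) + 2 * (2 ^ j)⁻¹ := by
  -- The correction `2 * 2 ^ (-j)` drops by `2 ^ (-j)` at each step, which absorbs the increment.
  have hanti : Antitone fun j => stepVal R X (M (climbAt R M X n j)) + 2 * (2 ^ j)⁻¹ := by
    refine antitone_nat_of_succ_le fun j => ?_
    have h2 : (2 : ℝ≥0) * (2 ^ (j + 1))⁻¹ = (2 ^ j)⁻¹ := by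
      rw [pow_succ]; field_simp
    rw [h2, two_mul, ← add_assoc]
    gcongr
    exact stepVal_climbAt_succ_le hM n X j
  rcases le_total i j with h | h
  · exact (monotone_stepVal_climbAt hM hmono n X h).trans le_self_add
  · exact le_self_add.trans (hanti h)

/-- Needed because an unbounded supremum in `ℝ≥0` would take the default value `0`. -/
theorem bddAbove_stepVal_climbAt (hM : StrictMono M) (hmono : ∀ X, Monotone (stepVal R X))
    (n : ℕ) (X : Cantor) :
    BddAbove (Set.range fun j => stepVal R X (M (climbAt R M X n j))) :=
  ⟨_, by rintro _ ⟨i, rfl⟩; exact stepVal_climbAt_le hM hmono n X i 0⟩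

theorem coe_stoppedLimit (hM : StrictMono M) (hmono : ∀ X, Monotone (stepVal R X))
    (n : ℕ) (X : Cantor) :
    (stoppedLimit R M n X : ℝ≥0∞) = ⨆ j, (stepVal R X (M (climbAt R M X n j)) : ℝ≥0∞) :=
  ENNReal.coe_iSup (bddAbove_stepVal_climbAt hM hmono n X)

/-- After `p + 1` attempts the remaining error is at most `2 * 2 ^ (-(p + 1)) = 2 ^ (-p)`, and `M (n
+ (p + 1))` bits of the oracle decide all these attempts. -/
theorem uniformlyComputableFun_stoppedLimit (hR : Computable R) (hMc : Computable M)
    (hM : StrictMono M) (hmono : ∀ X, Monotone (stepVal R X)) :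
    UniformlyComputableFun (stoppedLimit R M) := by
  have hcl : Computable fun a : (ℕ × ℕ) × List Bool =>
      M (climb (jump R M a.2) a.1.1 (a.1.2 + 1)) :=
    hMc.comp (Computable.climb (b := fun a : (ℕ × ℕ) × List Bool => jump R M a.2)
      ((computable_jump hR hMc).comp (Computable.snd.comp Computable.fst) Computable.snd)
      (Computable.fst.comp Computable.fst)
      ((Computable.snd.comp Computable.fst).nat_add' (Computable.const 1)))
  have hout : Computable fun a : (ℕ × ℕ) × List Bool =>
      R (a.2.take (M (climb (jump R M a.2) a.1.1 (a.1.2 + 1)))) * 2 ^ a.1.2 /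
        2 ^ M (climb (jump R M a.2) a.1.1 (a.1.2 + 1)) + 1 :=
    (((hR.comp (Computable.list_take' hcl Computable.snd)).nat_mul'
      ((Computable.const 2).nat_pow' (Computable.snd.comp Computable.fst))).nat_div'
        ((Computable.const 2).nat_pow' hcl)).nat_add' (Computable.const 1)
  have hlev : Computable fun a : (ℕ × ℕ) × List Bool =>
      decide (M (a.1.1 + (a.1.2 + 1)) ≤ a.2.length) :=
    Computable.decide_le (hMc.comp ((Computable.fst.comp Computable.fst).nat_add'
      ((Computable.snd.comp Computable.fst).nat_add' (Computable.const 1))))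
      (Computable.list_length.comp Computable.snd)
  refine ⟨_, Computable.ofOption (Computable.cond hlev (Computable.option_some.comp hout)
    (Computable.const none)), fun n p X => ⟨M (n + (p + 1)), ?_⟩, fun n p σ q hq X hX => ?_⟩
  · simp
  · have hσ : initSeg X σ.length = σ := hX
    by_cases hl : M (n + (p + 1)) ≤ σ.length
    · simp only [hl, decide_true, cond_true, Part.mem_coe, Option.mem_def, Option.some.injEq] at hq
      subst hq
      have hc : climb (jump R M σ) n (p + 1) = climbAt R M X n (p + 1) := by
        rw [← climb_jump_initSeg hM X hl, hσ]
      have htake : σ.take (M (climbAt R M X n (p + 1))) =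
          initSeg X (M (climbAt R M X n (p + 1))) := by
        rw [← hσ, take_initSeg]
        exact (hM.monotone (climb_le _ _ _)).trans hl
      rw [hc, htake]
      have h2 : (2 : ℝ≥0) * (2 ^ (p + 1))⁻¹ = (2 ^ p)⁻¹ := by
        rw [pow_succ]; field_simp
      refine dyadicApprox_round ?_ ?_
      · exact le_ciSup (bddAbove_stepVal_climbAt hM hmono n X) (p + 1)
      · rw [← h2]
        exact ciSup_le fun i => stepVal_climbAt_le hM hmono n X i (p + 1)
    · simp [hl] at hq

end Limit

end Schnorr

theorem lemma2p6 (t : Schnorr.Cantor → ℝ≥0∞) (ht : Schnorr.LowerSemicomputable t)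
    (I : ℝ≥0) (hI : Schnorr.ComputableNNReal I) (htI : ∫⁻ X, t X ∂Schnorr.coin = (I : ℝ≥0∞)) :
    ∃ h : ℕ → Schnorr.Cantor → ℝ≥0, Schnorr.UniformlyComputableFun h ∧
      (∀ n X, (h n X : ℝ≥0∞) ≤ t X) ∧
      ∀ A, Schnorr.SchnorrRandom A → ∃ n, (h n A : ℝ≥0∞) = t A := by
  obtain ⟨R, hR, hmono, hsup⟩ := ht.exists_stepVal
  obtain ⟨M, hMc, hM, hMI⟩ := Schnorr.exists_levels hR hmono hsup hI htI
  have hIle : ∀ m, ∫⁻ X, (Schnorr.stepVal R X m : ℝ≥0∞) ∂Schnorr.coin ≤ I := fun m => by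
    rw [← htI, Schnorr.lintegral_eq_iSup hmono hsup]
    exact le_iSup (fun m => ∫⁻ X, (Schnorr.stepVal R X m : ℝ≥0∞) ∂Schnorr.coin) m
  have htest := Schnorr.isSchnorrTest_jumpSet hR hMc hM
    (Schnorr.coin_jumpSet_le hM hmono hIle hMI)
  refine ⟨Schnorr.stoppedLimit R M, Schnorr.uniformlyComputableFun_stoppedLimit hR hMc hM hmono,
    fun n X => ?_, fun A hA => ?_⟩
  · rw [Schnorr.coe_stoppedLimit hM hmono, hsup]
    exact iSup_le fun j => le_iSup (fun m => (Schnorr.stepVal R X m : ℝ≥0∞)) _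
  · obtain ⟨n, hn⟩ : ∃ n, A ∉ ⋃ k, Schnorr.jumpSet R M (n + 1 + k) := by
      simpa only [Set.mem_iInter, not_forall] using hA _ htest
    have hno : ∀ k, n + 1 ≤ k → Schnorr.jump R M (Schnorr.initSeg A (M (k + 1))) k = false := by
      intro k hk
      rw [← Bool.not_eq_true]
      intro hj
      obtain ⟨i, rfl⟩ := Nat.exists_eq_add_of_le hk
      exact hn (Set.mem_iUnion.2 ⟨i, hj⟩)
    -- The `n`-th test set consists of the jumps from index `n + 1` on, so the climb from there is
    -- never blocked.
    refine ⟨n + 1, ?_⟩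
    rw [Schnorr.coe_stoppedLimit hM hmono, hsup]
    refine le_antisymm (iSup_le fun j =>
      le_iSup (fun m => (Schnorr.stepVal R A m : ℝ≥0∞)) _) (iSup_le fun m => ?_)
    -- After `m` attempts the level is `M (n + 1 + m) ≥ m`.
    refine le_iSup_of_le m (ENNReal.coe_le_coe.2 (hmono A ?_))
    rw [Schnorr.climbAt, Schnorr.climb_of_forall_false hno]
    exact (by omega : m ≤ n + 1 + m).trans hM.le_apply
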